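/- Let $\Pi=\{s\in\mathbb{C}:\operatorname{Re}s>0\}$, let $U_1=\{z\in\mathbb{C}:|z|<1\}$, and for $G\subset\mathbb{C}$ let $\widetilde G$ be the convex hull of $G$. For a domain (non-empty connected open set) $G\subset\mathbb{C}$ with $\widetilde G\neq\mathbb{C}$, the isometric Bohr abscissa $\mathbf{b}(G)$ is the infimum of those $\sigma\ge 0$ such that $$\sum_{n=2}^{\infty}\frac{|a_n|}{n^{\sigma}}<\operatorname{dist}(a_1,\partial\widetilde G)\qquad(*)$$ for every bounded holomorphic function $f$ on $\Pi$ with $f(\Pi)\subset G$ that is the sum $f(s)=\sum_{n\ge1}a_n n^{-s}$ of a Dirichlet series converging in $\Pi$. The abscissa $\mathbf{b}_a(G)$ is defined in the same way, but only with those $f$ whose Dirichlet series converges absolutely at every point of $\Pi$. A point $p\in\partial G\cap\partial\widetilde G$ is called a regular point of convexity of $G$ if there is an open disk $U\subset G$ with $p\in\partial U$. **Theorem 2.3.** Let $G$ be a domain in $\mathbb{C}$ with $\widetilde G\ne\mathbb{C}$. Then the sets of $\sigma$ defining $\mathbf{b}_a(G)$ and $\mathbf{b}(U_1)$ are non-empty,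 and $$\mathbf{b}_a(G)\le\mathbf{b}(U_1).$$ If $\partial G$ contains at least one regular point of convexity, then $\mathbf{b}_a(G)=\mathbf{b}(U_1)$. The same statements hold if in the definition of $\mathbf{b}_a(G)$ the functions $f$ are not required to be bounded. -/

import Mathlib

open Filter Topology

noncomputable section

namespace DirichletBohr

/-- The open right half-plane `Π = {s : Re s > 0}`. -/
def rightHalfPlane : Set ℂ := {s : ℂ | 0 < s.re}

/-- `f ∈ H^∞(Π)`: `f` is holomorphic and bounded on the right half-plane. -/
def IsHInfty (f : ℂ → ℂ) : Prop :=
  DifferentiableOn ℂ f rightHalfPlane ∧ ∃ C : ℝ, ∀ s ∈ rightHalfPlane, ‖f s‖ ≤ C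

/-- `f` is the sum on `Π` of the (possibly only conditionally) convergent ordinary Dirichlet
series `∑_{n ≥ 1} a n / n ^ s`.  The value `a 0` plays no role: `LSeries.term a s 0 = 0`. -/
def HasDirichletSeries (f : ℂ → ℂ) (a : ℕ → ℂ) : Prop :=
  ∀ s ∈ rightHalfPlane,
    Tendsto (fun N : ℕ => ∑ n ∈ Finset.range N, LSeries.term a s n) atTop (𝓝 (f s))

/-- `f` is the sum on `Π` of the absolutely convergent ordinary Dirichlet series
`∑_{n ≥ 1} a n / n ^ s` (in `ℂ`, unconditional and absolute summability coincide). -/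
def HasAbsDirichletSeries (f : ℂ → ℂ) (a : ℕ → ℂ) : Prop :=
  ∀ s ∈ rightHalfPlane, LSeriesHasSum a s (f s)

/-- The inequality `∑_{n ≥ 2} |a n| / n ^ σ < dist (a 1, ∂ G̃)`, with `G̃` the convex hull of `G`;
convergence of the series is part of the assertion. -/
def BohrInequality (G : Set ℂ) (a : ℕ → ℂ) (σ : ℝ) : Prop :=
  Summable (fun n : ℕ => ‖a (n + 2)‖ / ((n + 2 : ℕ) : ℝ) ^ σ) ∧
    ∑' n : ℕ, ‖a (n + 2)‖ / ((n + 2 : ℕ) : ℝ) ^ σ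
      < Metric.infDist (a 1) (frontier (convexHull ℝ G))

/-- The `σ ≥ 0` for which the Bohr inequality holds for all functions `f` with coefficients `a` in
the class `C` and with `f(Π) ⊆ G`. -/
def bohrSet (C : (ℂ → ℂ) → (ℕ → ℂ) → Prop) (G : Set ℂ) : Set ℝ :=
  {σ : ℝ | 0 ≤ σ ∧ ∀ (f : ℂ → ℂ) (a : ℕ → ℂ), C f a → Set.MapsTo f rightHalfPlane G →
    BohrInequality G a σ}

/-- The class of functions in `H^∞(Π)` given by a Dirichlet series converging in `Π`. -/
def convClass (f : ℂ → ℂ) (a : ℕ → ℂ) : Prop := IsHInfty f ∧ HasDirichletSeries f a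

/-- The class of functions in `H^∞(Π)` given by a Dirichlet series converging absolutely in `Π`. -/
def absClass (f : ℂ → ℂ) (a : ℕ → ℂ) : Prop := IsHInfty f ∧ HasAbsDirichletSeries f a

/-- The isometric Bohr abscissa `b(G)`. -/
def bohrAbscissa (G : Set ℂ) : ℝ := sInf (bohrSet convClass G)

/-- The abscissa `b_a(G)`: as `b(G)`, but only for absolutely convergent Dirichlet series. -/
def absBohrAbscissa (G : Set ℂ) : ℝ := sInf (bohrSet absClass G)

/-- The variant of `b_a(G)` in which the functions need not be bounded on `Π`. -/
def absBohrAbscissaUnbdd (G : Set ℂ) : ℝ := sInf (bohrSet HasAbsDirichletSeries G)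

/-- `p ∈ ∂G` is a point of convexity of `G` if it lies on the boundary of the convex hull. -/
def IsPointOfConvexity (G : Set ℂ) (p : ℂ) : Prop :=
  p ∈ frontier G ∧ p ∈ frontier (convexHull ℝ G)

/-- A point of convexity is regular if it lies on the boundary of an open disk contained
in `G`. -/
def IsRegularPointOfConvexity (G : Set ℂ) (p : ℂ) : Prop :=
  IsPointOfConvexity G p ∧
    ∃ (c : ℂ) (r : ℝ), 0 < r ∧ Metric.ball c r ⊆ G ∧ p ∈ frontier (Metric.ball c r)

end DirichletBohr

end

namespace DirichletBohr

open MeasureTheory ProbabilityTheory LSeries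

/-! The half-plane is the extremal convex set, and it is a limit of disks. If `h` is absolutely
convergent with nonnegative real part, a shift to the right by `η` makes it bounded, so `1 - ε (h +
η)` maps into the unit disk for small `ε`. To first order in `ε`, the Bohr inequality of the disk
becomes one with bound `Re a₁ + η`, and `η → 0` gives `sum_le_re_of_mem_bohrSet`. For general `G`, a
half-plane containing the convex hull and bounded by a line through the boundary point nearest to
`a₁` gives the upper bound. Boundedness of `f` is never needed here.

Conversely, at a regular point `p` a disk inside `G` touches the boundary of the hull, so the
distance from a point of the radius towards `p` to that boundary is at most its distance to `p`. A
function into the unit disk, rotated and scaled into this disk so that its constant term lies on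
that radius, inherits the inequality of `G`. Its series need only converge, so it is first averaged
over vertical lines against a Gaussian of variance `v`. This keeps values in the closed disk and
multiplies `a n` by `exp (-v (log n)² / 2)`, which forces absolute convergence; then `v → 0`.

The set for the disk is non-empty by a Carathéodory bound (`norm_coeff_le`). Limits only yield
non-strict inequalities; any larger `σ` restores strictness (`bohrInequality_of_sum_le`), which does
not affect infima. -/

lemma isOpen_rightHalfPlane : IsOpen rightHalfPlane :=
  isOpen_lt continuous_const Complex.continuous_re

lemma convex_rightHalfPlane : Convex ℝ rightHalfPlane := convex_halfSpace_re_gt 0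

/-! ### Elementary facts on Dirichlet series converging in the right half-plane -/

lemma HasAbsDirichletSeries.hasDirichletSeries {f : ℂ → ℂ} {a : ℕ → ℂ}
    (h : HasAbsDirichletSeries f a) : HasDirichletSeries f a :=
  fun s hs => (h s hs).tendsto_sum_nat

lemma HasAbsDirichletSeries.affine {f : ℂ → ℂ} {a : ℕ → ℂ}
    (h : HasAbsDirichletSeries f a) (α β : ℂ) :
    HasAbsDirichletSeries (fun s => α + β * f s) (α • LSeries.delta + β • a) := by
  intro s hs
  have h1 : LSeriesHasSum LSeries.delta s 1 := by
    have : (fun n => term LSeries.delta s n) = fun n => if n = 1 then 1 else 0 :=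
      funext fun n => LSeries.term_delta s n
    unfold LSeriesHasSum
    simpa [this] using hasSum_ite_eq 1 (1 : ℂ)
  simpa using (h1.smul α).add ((h s hs).smul β)

lemma HasAbsDirichletSeries.shift {f : ℂ → ℂ} {a : ℕ → ℂ}
    (h : HasAbsDirichletSeries f a) {η : ℝ} (hη : 0 ≤ η) :
    HasAbsDirichletSeries (fun s => f (s + η)) (fun n => a n / (n : ℂ) ^ (η : ℂ)) := by
  intro s hs
  have hs' : s + η ∈ rightHalfPlane := by
    simp only [rightHalfPlane, Set.mem_ofPred_eq, Complex.add_re, Complex.ofReal_re] at hs ⊢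
    linarith
  refine (h _ hs').congr_fun fun n => ?_
  rcases eq_or_ne n 0 with rfl | hn
  · simp
  · rw [term_of_ne_zero hn, term_of_ne_zero hn, Complex.cpow_add _ _ (Nat.cast_ne_zero.2 hn),
      div_div, mul_comm]

lemma abscissaOfAbsConv_le_of_forall_summable {a : ℕ → ℂ} {x : ℝ}
    (h : ∀ s : ℂ, x < s.re → LSeriesSummable a s) : abscissaOfAbsConv a ≤ x :=
  abscissaOfAbsConv_le_of_forall_lt_LSeriesSummable fun y hy => h y (by simpa using hy)

lemma HasAbsDirichletSeries.eqOn_LSeries {f : ℂ → ℂ} {a : ℕ → ℂ}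
    (h : HasAbsDirichletSeries f a) : Set.EqOn f (LSeries a) rightHalfPlane :=
  fun s hs => (h s hs).LSeries_eq.symm

lemma HasAbsDirichletSeries.differentiableOn {f : ℂ → ℂ} {a : ℕ → ℂ}
    (h : HasAbsDirichletSeries f a) : DifferentiableOn ℂ f rightHalfPlane := by
  have h0 : abscissaOfAbsConv a ≤ (0 : ℝ) :=
    abscissaOfAbsConv_le_of_forall_summable fun s hs => (h s hs).LSeriesSummable
  refine ((LSeries_differentiableOn a).mono fun s hs => ?_).congr h.eqOn_LSeries
  exact h0.trans_lt (by exact_mod_cast hs)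

/-- The terms of a convergent series at the point `x` are bounded. This polynomial growth yields
absolute convergence for `Re s > 1`. -/
lemma HasDirichletSeries.exists_norm_le {f : ℂ → ℂ} {a : ℕ → ℂ} (h : HasDirichletSeries f a)
    {x : ℝ} (hx : 0 < x) : ∃ C : ℝ, ∀ n ≠ 0, ‖a n‖ ≤ C * (n : ℝ) ^ x := by
  have h1 := h (x : ℂ) (by simpa [rightHalfPlane] using hx)
  have h2 : Tendsto (fun n => term a (x : ℂ) n) atTop (𝓝 0) := by
    have := ((tendsto_add_atTop_iff_nat 1).2 h1).sub h1
    simpa [Finset.sum_range_succ] using this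
  obtain ⟨C, hC⟩ := h2.norm.bddAbove_range
  refine ⟨C, fun n hn => ?_⟩
  have h3 : ‖term a (x : ℂ) n‖ ≤ C := hC ⟨n, rfl⟩
  rw [norm_term_eq, if_neg hn, Complex.ofReal_re] at h3
  rwa [div_le_iff₀ (Real.rpow_pos_of_pos (by positivity) _)] at h3

lemma HasDirichletSeries.summable {f : ℂ → ℂ} {a : ℕ → ℂ} (h : HasDirichletSeries f a)
    {s : ℂ} (hs : 1 < s.re) : LSeriesSummable a s := by
  obtain ⟨C, hC⟩ := h.exists_norm_le (x := (s.re - 1) / 2) (by linarith)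
  exact LSeriesSummable_of_le_const_mul_rpow (x := (s.re - 1) / 2 + 1) (by linarith)
    ⟨C, by simpa using hC⟩

lemma HasDirichletSeries.hasSum {f : ℂ → ℂ} {a : ℕ → ℂ} (h : HasDirichletSeries f a)
    {s : ℂ} (hs : 1 < s.re) : LSeriesHasSum a s (f s) := by
  have h1 := (h.summable hs).LSeriesHasSum
  have h2 := tendsto_nhds_unique h1.tendsto_sum_nat (h s (zero_lt_one.trans hs))
  rwa [h2] at h1

lemma HasDirichletSeries.tendsto {f : ℂ → ℂ} {a : ℕ → ℂ} (h : HasDirichletSeries f a) :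
    Tendsto (fun x : ℝ => f x) atTop (𝓝 (a 1)) := by
  have h0 : abscissaOfAbsConv a ≤ (1 : ℝ) :=
    abscissaOfAbsConv_le_of_forall_summable fun s hs => h.summable hs
  refine (LSeries.tendsto_atTop (h0.trans_lt (EReal.coe_lt_top 1))).congr' ?_
  filter_upwards [eventually_gt_atTop 1] with x hx
  exact (h.hasSum (by simpa using hx)).LSeries_eq

lemma HasDirichletSeries.eq_of_forall_eq_zero {f : ℂ → ℂ} {a : ℕ → ℂ}
    (h : HasDirichletSeries f a) (ha : ∀ n, a (n + 2) = 0) {s : ℂ} (hs : s ∈ rightHalfPlane) :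
    f s = a 1 := by
  refine tendsto_nhds_unique ((tendsto_add_atTop_iff_nat 2).2 (h s hs)) ?_
  refine tendsto_const_nhds.congr fun N => ?_
  induction N with
  | zero => simp [Finset.sum_range_succ, term_of_ne_zero]
  | succ N ih =>
    rw [show N + 1 + 2 = N + 2 + 1 by ring, Finset.sum_range_succ, ← ih,
      term_of_ne_zero (by omega), ha, zero_div, add_zero]

/-- Enlarging `σ` turns a non-strict Bohr inequality for all partial sums into the strict one. -/
lemma bohrInequality_of_sum_le {G K : Set ℂ} {f : ℂ → ℂ} {a : ℕ → ℂ} {σ σ' : ℝ}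
    (h : HasDirichletSeries f a) (hf : Set.MapsTo f rightHalfPlane K)
    (hK : ∀ z ∈ K, 0 < Metric.infDist z (frontier (convexHull ℝ G))) (hσ : σ < σ')
    (hsum : ∀ N : ℕ, ∑ n ∈ Finset.range N, ‖a (n + 2)‖ / ((n + 2 : ℕ) : ℝ) ^ σ
      ≤ Metric.infDist (a 1) (frontier (convexHull ℝ G))) :
    BohrInequality G a σ' := by
  set d := Metric.infDist (a 1) (frontier (convexHull ℝ G))
  have hpos : ∀ n : ℕ, 0 < ((n + 2 : ℕ) : ℝ) := fun n => by positivity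
  have hnn : ∀ n : ℕ, 0 ≤ ‖a (n + 2)‖ / ((n + 2 : ℕ) : ℝ) ^ σ := fun n => by positivity
  have hs : Summable fun n : ℕ => ‖a (n + 2)‖ / ((n + 2 : ℕ) : ℝ) ^ σ :=
    summable_of_sum_range_le hnn hsum
  have hle : ∑' n : ℕ, ‖a (n + 2)‖ / ((n + 2 : ℕ) : ℝ) ^ σ ≤ d :=
    hs.tsum_le_of_sum_range_le hsum
  -- If `d = 0`, all later coefficients vanish and `f` is the constant `a 1`, which then lies in
  -- `K`, at positive distance from the frontier.
  have hd : 0 < d := by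
    by_contra hd
    have hd0 : d = 0 := le_antisymm (not_lt.1 hd) Metric.infDist_nonneg
    have h0 : ∀ n, a (n + 2) = 0 := fun n => by
      have h1 := hs.le_tsum n fun m _ => hnn m
      have h2 : ‖a (n + 2)‖ / ((n + 2 : ℕ) : ℝ) ^ σ ≤ 0 := by linarith
      rw [div_le_iff₀ (Real.rpow_pos_of_pos (hpos n) _), zero_mul] at h2
      exact norm_le_zero_iff.1 h2
    have h1 : (1 : ℂ) ∈ rightHalfPlane := by simp [rightHalfPlane]
    have := hK _ (hf h1)
    rw [h.eq_of_forall_eq_zero h0 h1] at this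
    exact hd this
  have hterm : ∀ n : ℕ, ‖a (n + 2)‖ / ((n + 2 : ℕ) : ℝ) ^ σ' ≤
      (2 : ℝ) ^ (σ - σ') * (‖a (n + 2)‖ / ((n + 2 : ℕ) : ℝ) ^ σ) := fun n => by
    have h1 : ((n + 2 : ℕ) : ℝ) ^ (σ - σ') ≤ (2 : ℝ) ^ (σ - σ') :=
      Real.rpow_le_rpow_of_nonpos two_pos (by push_cast; linarith [n.cast_nonneg (α := ℝ)])
        (by linarith)
    calc ‖a (n + 2)‖ / ((n + 2 : ℕ) : ℝ) ^ σ'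
        = ((n + 2 : ℕ) : ℝ) ^ (σ - σ') * (‖a (n + 2)‖ / ((n + 2 : ℕ) : ℝ) ^ σ) := by
          rw [Real.rpow_sub (hpos n)]
          have := Real.rpow_pos_of_pos (hpos n) σ
          have := Real.rpow_pos_of_pos (hpos n) σ'
          field_simp
      _ ≤ _ := mul_le_mul_of_nonneg_right h1 (hnn n)
  have hs' : Summable fun n : ℕ => ‖a (n + 2)‖ / ((n + 2 : ℕ) : ℝ) ^ σ' :=
    (hs.mul_left ((2 : ℝ) ^ (σ - σ'))).of_nonneg_of_le (fun n => by positivity) hterm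
  refine ⟨hs', ?_⟩
  calc _ ≤ ∑' n : ℕ, (2 : ℝ) ^ (σ - σ') * (‖a (n + 2)‖ / ((n + 2 : ℕ) : ℝ) ^ σ) :=
        hs'.tsum_le_tsum hterm (hs.mul_left _)
    _ = (2 : ℝ) ^ (σ - σ') * ∑' n : ℕ, ‖a (n + 2)‖ / ((n + 2 : ℕ) : ℝ) ^ σ := tsum_mul_left
    _ ≤ (2 : ℝ) ^ (σ - σ') * d := by gcongr
    _ < 1 * d := by
        gcongr
        exact Real.rpow_lt_one_of_one_lt_of_neg one_lt_two (by linarith)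
    _ = d := one_mul d

/-! ### Gaussian averages along vertical lines -/

lemma integral_exp_gaussianReal (v : NNReal) (u : ℝ) :
    ∫ t, Complex.exp (u * t * Complex.I) ∂(gaussianReal 0 v) = Real.exp (-(v * u ^ 2 / 2)) := by
  rw [← charFun_apply_real, charFun_gaussianReal]
  push_cast
  congr 1
  ring

lemma term_add_mul_I (a : ℕ → ℂ) (s : ℂ) (u t : ℝ) (n : ℕ) :
    term a (s + t * Complex.I) n * Complex.exp (u * t * Complex.I) =
      term a s n * Complex.exp ((u - Real.log n : ℝ) * t * Complex.I) := by
  rcases eq_or_ne n 0 with rfl | hn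
  · simp
  · have hn' : (n : ℂ) ≠ 0 := Nat.cast_ne_zero.2 hn
    rw [term_of_ne_zero hn, term_of_ne_zero hn, Complex.cpow_add _ _ hn',
      Complex.cpow_def_of_ne_zero hn' (t * Complex.I), ← Complex.natCast_log, div_mul_eq_mul_div,
      div_mul_eq_mul_div, ← div_div, div_right_comm, mul_div_assoc, ← Complex.exp_sub]
    congr 3
    push_cast
    ring

/-- Along a vertical line the `n`-th term oscillates with frequency `-log n`. Termwise integration
therefore replaces each oscillation by the Gaussian characteristic function at `u - log n`. -/
lemma hasSum_integral_gaussianReal {a : ℕ → ℂ} {s : ℂ} (h : LSeriesSummable a s) (v : NNReal)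
    (u : ℝ) :
    HasSum (fun n : ℕ => term a s n * Real.exp (-(v * (u - Real.log n) ^ 2 / 2)))
      (∫ t : ℝ, LSeries a (s + t * Complex.I) * Complex.exp (u * t * Complex.I)
        ∂(gaussianReal 0 v)) := by
  have hnorm : ∀ (n : ℕ) (t : ℝ),
      ‖term a s n * Complex.exp ((u - Real.log n : ℝ) * t * Complex.I)‖ = ‖term a s n‖ := by
    intro n t
    rw [norm_mul, ← Complex.ofReal_mul, Complex.norm_exp_ofReal_mul_I, mul_one]
  have key := hasSum_integral_of_summable_integral_norm (μ := gaussianReal 0 v)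
    (F := fun (n : ℕ) (t : ℝ) =>
      term a s n * Complex.exp ((u - Real.log n : ℝ) * t * Complex.I))
    (fun n => Integrable.of_bound (C := ‖term a s n‖)
      (Continuous.aestronglyMeasurable (by fun_prop)) (ae_of_all _ fun t => (hnorm n t).le))
    (by simpa only [hnorm, integral_const, probReal_univ, one_smul] using h.norm)
  simp_rw [integral_const_mul, integral_exp_gaussianReal] at key
  refine (congrArg (HasSum _) (integral_congr_ae (ae_of_all _ fun t => ?_))).mpr key
  simp only [LSeries, ← tsum_mul_right, term_add_mul_I]

lemma add_mul_I_mem {s : ℂ} (hs : s ∈ rightHalfPlane) (t : ℝ) :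
    s + t * Complex.I ∈ rightHalfPlane := by
  simpa [rightHalfPlane] using hs

lemma continuous_comp_vertical {f : ℂ → ℂ} (hf : ContinuousOn f rightHalfPlane) {s : ℂ}
    (hs : s ∈ rightHalfPlane) : Continuous fun t : ℝ => f (s + t * Complex.I) :=
  hf.comp_continuous (by fun_prop) (add_mul_I_mem hs)

lemma differentiableOn_integral_vertical {f : ℂ → ℂ} (hf : IsHInfty f) (μ : Measure ℝ)
    [IsFiniteMeasure μ] :
    DifferentiableOn ℂ (fun s => ∫ t : ℝ, f (s + t * Complex.I) ∂μ) rightHalfPlane := by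
  obtain ⟨hd, C, hC⟩ := hf
  intro s hs
  have hr : 0 < s.re / 2 := half_pos hs
  have hd' : DifferentiableOn ℂ (deriv f) rightHalfPlane := hd.deriv isOpen_rightHalfPlane
  have hball : ∀ z ∈ Metric.ball s (s.re / 2), s.re / 2 < z.re := fun z hz => by
    have h1 : |(z - s).re| < s.re / 2 :=
      (Complex.abs_re_le_norm _).trans_lt (by simpa [dist_eq_norm] using hz)
    have h2 := (abs_lt.1 h1).1
    rw [Complex.sub_re] at h2
    linarith
  have hmem : ∀ z ∈ Metric.ball s (s.re / 2), z ∈ rightHalfPlane := fun z hz =>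
    hr.trans (hball z hz)
  have hmeas : ∀ z ∈ rightHalfPlane,
      AEStronglyMeasurable (fun t : ℝ => f (z + t * Complex.I)) μ := fun z hz =>
    (continuous_comp_vertical hd.continuousOn hz).aestronglyMeasurable
  refine (hasDerivAt_integral_of_dominated_loc_of_deriv_le (𝕜 := ℂ)
    (F := fun s (t : ℝ) => f (s + t * Complex.I))
    (F' := fun s (t : ℝ) => deriv f (s + t * Complex.I))
    (bound := fun _ => C / (s.re / 4))
    (Metric.ball_mem_nhds s hr) ?_ ?_ ?_ ?_ (integrable_const _) ?_).2
      |>.differentiableAt.differentiableWithinAt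
  · filter_upwards [isOpen_rightHalfPlane.mem_nhds hs] with z hz using hmeas z hz
  · exact Integrable.of_bound (hmeas s hs) C (ae_of_all _ fun t => hC _ (add_mul_I_mem hs t))
  · exact (continuous_comp_vertical hd'.continuousOn hs).aestronglyMeasurable
  · refine ae_of_all _ fun t z hz => ?_
    -- Since `z.re > s.re / 2`, this disk stays in the half-plane, and Cauchy's estimate on it gives
    -- a bound uniform in `t` and `z`.
    have hsub : Metric.closedBall (z + t * Complex.I) (s.re / 4) ⊆ rightHalfPlane := by
      intro w hw
      have h1 : |(w - (z + t * Complex.I)).re| ≤ s.re / 4 :=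
        (Complex.abs_re_le_norm _).trans (by simpa [dist_eq_norm] using hw)
      have h2 := (abs_le.1 h1).1
      have h3 := hball z hz
      simp only [Complex.sub_re, Complex.add_re, Complex.mul_re, Complex.ofReal_re, Complex.I_re,
        Complex.ofReal_im, Complex.I_im] at h2
      change 0 < w.re
      linarith
    refine Complex.norm_deriv_le_of_forall_mem_sphere_norm_le (by linarith) ?_ fun w hw =>
      hC w (hsub (Metric.sphere_subset_closedBall hw))
    refine DifferentiableOn.diffContOnCl ?_
    exact hd.mono ((closure_mono Metric.ball_subset_closedBall).trans
      (by rw [Metric.isClosed_closedBall.closure_eq]; exact hsub))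
  · refine ae_of_all _ fun t z hz => ?_
    have h1 : HasDerivAt f (deriv f (z + t * Complex.I)) (z + t * Complex.I) :=
      (hd.differentiableAt
        (isOpen_rightHalfPlane.mem_nhds (add_mul_I_mem (hmem z hz) t))).hasDerivAt
    exact h1.comp_add_const z _

/-- Completing the square in `log n`: the Gaussian factor beats every power of `n`. -/
lemma exists_mul_exp_le (v x y : ℝ) (hv : 0 < v) :
    ∃ C : ℝ, ∀ n : ℕ, n ≠ 0 →
      (n : ℝ) ^ x * Real.exp (-(v * Real.log n ^ 2 / 2)) ≤ C * (n : ℝ) ^ y := by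
  refine ⟨Real.exp ((x - y) ^ 2 / (2 * v)), fun n hn => ?_⟩
  have hn' : (0 : ℝ) < n := by positivity
  rw [Real.rpow_def_of_pos hn', Real.rpow_def_of_pos hn', ← Real.exp_add, ← Real.exp_add]
  refine Real.exp_le_exp.2 ?_
  have h : 0 ≤ (v * Real.log n - (x - y)) ^ 2 / (2 * v) := by positivity
  have h2 : (v * Real.log n - (x - y)) ^ 2 / (2 * v) =
      (x - y) ^ 2 / (2 * v) + Real.log n * y
        - (Real.log n * x + -(v * Real.log n ^ 2 / 2)) := by
    field_simp
    ring
  linarith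

/-- Gaussian smoothing turns a bounded sum of a convergent Dirichlet series into the sum of
an absolutely convergent one. -/
lemma hasAbsDirichletSeries_integral_gaussianReal {f : ℂ → ℂ} {a : ℕ → ℂ} (h : convClass f a)
    {v : NNReal} (hv : 0 < v) :
    HasAbsDirichletSeries (fun s => ∫ t : ℝ, f (s + t * Complex.I) ∂(gaussianReal 0 v))
      (fun n => a n * Real.exp (-(v * Real.log n ^ 2 / 2))) := by
  set b : ℕ → ℂ := fun n => a n * Real.exp (-(v * Real.log n ^ 2 / 2))
  set g : ℂ → ℂ := fun s => ∫ t : ℝ, f (s + t * Complex.I) ∂(gaussianReal 0 v)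
  have hsum : ∀ s : ℂ, LSeriesSummable b s := fun s => by
    obtain ⟨C, hC⟩ := h.2.exists_norm_le one_pos
    obtain ⟨D, hD⟩ := exists_mul_exp_le v 1 (s.re - 1 - 1) hv
    have hC0 : 0 ≤ C := (norm_nonneg _).trans (by simpa using hC 1 one_ne_zero)
    refine LSeriesSummable_of_le_const_mul_rpow (x := s.re - 1) (by linarith)
      ⟨C * D, fun n hn => ?_⟩
    have h1 : ‖b n‖ = ‖a n‖ * Real.exp (-(v * Real.log n ^ 2 / 2)) := by
      simp only [b, norm_mul, Complex.norm_real, Real.norm_eq_abs, Real.abs_exp]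
    calc ‖b n‖ ≤ C * (n : ℝ) ^ (1 : ℝ) * Real.exp (-(v * Real.log n ^ 2 / 2)) := by
          rw [h1]
          gcongr
          exact hC n hn
      _ ≤ C * (D * (n : ℝ) ^ (s.re - 1 - 1)) := by
          rw [mul_assoc]
          exact mul_le_mul_of_nonneg_left (hD n hn) hC0
      _ = _ := by ring
  have hb : HasAbsDirichletSeries (LSeries b) b := fun s _ => (hsum s).LSeriesHasSum
  have heq : ∀ s : ℂ, 1 < s.re → g s = LSeries b s := fun s hs => by
    have h1 := hasSum_integral_gaussianReal (h.2.summable hs) v 0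
    have h2 : HasSum (fun n => term b s n) (g s) := by
      convert h1 using 1
      · funext n
        rcases eq_or_ne n 0 with rfl | hn
        · simp
        · rw [term_of_ne_zero hn, term_of_ne_zero hn, zero_sub, neg_sq, mul_div_right_comm]
      · refine integral_congr_ae (ae_of_all _ fun t => ?_)
        have h3 : 1 < (s + t * Complex.I).re := by simpa using hs
        simp [(h.2.hasSum h3).LSeries_eq]
    exact (LSeriesHasSum.LSeries_eq h2).symm
  -- Termwise integration is justified only for `Re s > 1`; the identity theorem carries the
  -- equality to the whole half-plane.
  have hEq : Set.EqOn g (LSeries b) rightHalfPlane := by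
    refine AnalyticOnNhd.eqOn_of_preconnected_of_eventuallyEq (z₀ := 2)
      ((differentiableOn_integral_vertical h.1 _).analyticOnNhd isOpen_rightHalfPlane)
      (hb.differentiableOn.analyticOnNhd isOpen_rightHalfPlane)
      convex_rightHalfPlane.isPreconnected (by simp [rightHalfPlane]) ?_
    filter_upwards [(isOpen_lt continuous_const Complex.continuous_re).mem_nhds
      (show (1 : ℝ) < (2 : ℂ).re by simp)] with s hs using heq s hs
  intro s hs
  rw [hEq hs]
  exact hb s hs

/-! ### The mean value formulas for the coefficients -/

/-- As the variance tends to infinity, only the frequency `u` survives. If `u` is no `log n`, the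
choice `m = 0` makes the limit zero, because the term at `0` vanishes. -/
lemma tendsto_integral_gaussianReal {a : ℕ → ℂ} {s : ℂ} (h : LSeriesSummable a s) (u : ℝ)
    (m : ℕ) (hm : ∀ n ≠ 0, n ≠ m → Real.log n ≠ u) (hu : term a s m ≠ 0 → Real.log m = u) :
    Tendsto (fun k : ℕ => ∫ t : ℝ, LSeries a (s + t * Complex.I) * Complex.exp (u * t * Complex.I)
        ∂(gaussianReal 0 k)) atTop (𝓝 (term a s m)) := by
  have h1 : ∑' n, (if n = m then term a s m else 0) = term a s m := tsum_ite_eq m _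
  rw [← h1]
  simp_rw [← fun k : ℕ => (hasSum_integral_gaussianReal h (k : NNReal) u).tsum_eq]
  refine tendsto_tsum_of_dominated_convergence (bound := fun n => ‖term a s n‖) h.norm ?_ ?_
  · intro n
    split_ifs with hn
    · subst hn
      rcases eq_or_ne (term a s n) 0 with h0 | h0
      · simp [h0]
      · simp [hu h0]
    · rcases eq_or_ne n 0 with rfl | hn0
      · simp
      · have hne : 0 < (u - Real.log n) ^ 2 / 2 := by
          have := sub_ne_zero.2 (hm n hn0 hn).symm
          positivity
        have h2 : Tendsto (fun k : ℕ => Real.exp (-((k : ℝ) * ((u - Real.log n) ^ 2 / 2))))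
            atTop (𝓝 0) :=
          Real.tendsto_exp_neg_atTop_nhds_zero.comp
            (tendsto_natCast_atTop_atTop.atTop_mul_const hne)
        have h3 := ((Complex.continuous_ofReal.tendsto 0).comp h2).const_mul (term a s n)
        rw [Complex.ofReal_zero, mul_zero] at h3
        refine h3.congr fun k => ?_
        simp only [Function.comp_apply, NNReal.coe_natCast, mul_div_assoc]
  · refine Eventually.of_forall fun k n => ?_
    rw [norm_mul]
    refine mul_le_of_le_one_right (norm_nonneg _) ?_
    rw [Complex.norm_real, Real.norm_eq_abs, Real.abs_exp, Real.exp_le_one_iff, neg_nonpos]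
    positivity

lemma exists_norm_eq_one_mul_eq (z w : ℂ) (hw : ‖w‖ = 1) :
    ∃ u : ℂ, ‖u‖ = 1 ∧ u * z = ‖z‖ * w := by
  rcases eq_or_ne z 0 with rfl | hz
  · exact ⟨1, by simp⟩
  · have hz' : (‖z‖ : ℂ) ≠ 0 := by simpa using hz
    refine ⟨‖z‖ * w / z, ?_, by field_simp⟩
    simp [hw, hz]

/-- The Carathéodory type bound for the coefficients of a Dirichlet series with values in the
unit disk. -/
lemma norm_coeff_le {f : ℂ → ℂ} {a : ℕ → ℂ} (h : convClass f a)
    (hf : Set.MapsTo f rightHalfPlane (Metric.ball 0 1)) (n : ℕ) (hn : 2 ≤ n) :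
    ‖a n‖ / (n : ℝ) ^ (2 : ℝ) ≤ 2 * (1 - ‖a 1‖) := by
  obtain ⟨c, hc, hca⟩ := exists_norm_eq_one_mul_eq (a 1) 1 norm_one
  have hsum : LSeriesSummable a 2 := h.2.summable (by simp)
  have hn1 : (1 : ℝ) < n := by exact_mod_cast hn
  have hu : 0 < Real.log n := Real.log_pos hn1
  set u := Real.log n
  set F : ℝ → ℂ := fun t => f (2 + t * Complex.I)
  have hF : ∀ t, F t = LSeries a (2 + t * Complex.I) := fun t =>
    (h.2.hasSum (by simp)).LSeries_eq.symm
  have h2mem : (2 : ℂ) ∈ rightHalfPlane := by simp [rightHalfPlane]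
  have hFc : Continuous F := continuous_comp_vertical h.1.1.continuousOn h2mem
  have hF1 : ∀ t, ‖F t‖ ≤ 1 := fun t => by
    simpa using (mem_ball_zero_iff.1 (hf (add_mul_I_mem h2mem t))).le
  have hexp : ∀ x t : ℝ, ‖Complex.exp (x * t * Complex.I)‖ = 1 := fun x t => by
    rw [← Complex.ofReal_mul, Complex.norm_exp_ofReal_mul_I]
  have hint : ∀ (k : ℕ) (x : ℝ), Integrable (fun t : ℝ => F t * Complex.exp (x * t * Complex.I))
      (gaussianReal 0 k) := fun k x =>
    Integrable.of_bound (C := 1) (Continuous.aestronglyMeasurable (by fun_prop))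
      (ae_of_all _ fun t => by rw [norm_mul, hexp, mul_one]; exact hF1 t)
  have hint' : ∀ (k : ℕ) (x : ℝ), Integrable (fun t : ℝ => Complex.exp (x * t * Complex.I))
      (gaussianReal 0 k) := fun k x =>
    Integrable.of_bound (C := 1) (Continuous.aestronglyMeasurable (by fun_prop))
      (ae_of_all _ fun t => (hexp x t).le)
  have hA : Tendsto (fun k : ℕ => ∫ t : ℝ, F t ∂(gaussianReal 0 k)) atTop (𝓝 (a 1)) := by
    have := tendsto_integral_gaussianReal hsum 0 1
      (fun j hj hj1 => Real.log_ne_zero_of_pos_of_ne_one (by positivity) (by exact_mod_cast hj1))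
      (by simp)
    simpa [term_of_ne_zero, ← hF] using this
  have hB := tendsto_integral_gaussianReal hsum u n
    (fun j hj hjn h => hjn (by
      have := Real.log_injOn_pos (Set.mem_Ioi.2 (by positivity : (0 : ℝ) < j))
        (Set.mem_Ioi.2 (by positivity : (0 : ℝ) < n)) h
      exact_mod_cast this)) (fun _ => rfl)
  have hC := tendsto_integral_gaussianReal hsum (-u) 0
    (fun j hj _ h => by have := Real.log_natCast_nonneg j; linarith) (by simp)
  have hD : Tendsto (fun k : ℕ => ∫ t : ℝ, Complex.exp (u * t * Complex.I) ∂(gaussianReal 0 k))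
      atTop (𝓝 0) := by
    have h2 : Tendsto (fun k : ℕ => Real.exp (-((k : ℝ) * (u ^ 2 / 2)))) atTop (𝓝 0) :=
      Real.tendsto_exp_neg_atTop_nhds_zero.comp
        (tendsto_natCast_atTop_atTop.atTop_mul_const (by positivity))
    have h3 := (Complex.continuous_ofReal.tendsto 0).comp h2
    rw [Complex.ofReal_zero] at h3
    refine h3.congr fun k => ?_
    rw [integral_exp_gaussianReal]
    simp only [Function.comp_apply, NNReal.coe_natCast, mul_div_assoc]
  simp_rw [← hF] at hB hC
  have hconj : ∀ z : ℂ, ((z.re : ℝ) : ℂ) = (z + (starRingEnd ℂ) z) / 2 := fun z =>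
    Complex.re_eq_add_conj z
  -- The function `1 - Re (c F)` is nonnegative, so its Fourier coefficient at `u` is at most its
  -- mean in modulus. In the limit only `c * a n / n ^ 2` remains on the left: the constant `1` has
  -- no frequency `u`, and `F` has none at `-u < 0`.
  have key : ∀ k : ℕ,
      ‖(∫ t : ℝ, Complex.exp (u * t * Complex.I) ∂(gaussianReal 0 k)) -
        (c * (∫ t : ℝ, F t * Complex.exp (u * t * Complex.I) ∂(gaussianReal 0 k)) +
          (starRingEnd ℂ) (c * ∫ t : ℝ, F t * Complex.exp ((-u : ℝ) * t * Complex.I)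
            ∂(gaussianReal 0 k))) / 2‖ ≤
      1 - (c * ∫ t : ℝ, F t ∂(gaussianReal 0 k)).re := by
    intro k
    have hFi : Integrable F (gaussianReal 0 k) := by simpa using hint k 0
    have hFi' : Integrable (fun t => c * F t) (gaussianReal 0 k) := hFi.const_mul c
    have e1 : ∫ t : ℝ, ((1 - (c * F t).re : ℝ) : ℂ) * Complex.exp (u * t * Complex.I)
        ∂(gaussianReal 0 k) = (∫ t : ℝ, Complex.exp (u * t * Complex.I) ∂(gaussianReal 0 k)) -
        (c * (∫ t : ℝ, F t * Complex.exp (u * t * Complex.I) ∂(gaussianReal 0 k)) +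
          (starRingEnd ℂ) (c * ∫ t : ℝ, F t * Complex.exp ((-u : ℝ) * t * Complex.I)
            ∂(gaussianReal 0 k))) / 2 := by
      rw [← integral_const_mul, ← integral_const_mul, ← integral_conj, ← integral_add,
        ← integral_div, ← integral_sub]
      · refine integral_congr_ae (ae_of_all _ fun t => ?_)
        have e2 : (starRingEnd ℂ) (Complex.exp ((-u : ℝ) * t * Complex.I)) =
            Complex.exp (u * t * Complex.I) := by
          rw [← Complex.exp_conj]
          simp
        simp only [map_mul, e2]
        rw [Complex.ofReal_sub, hconj, map_mul, Complex.ofReal_one]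
        ring
      · exact hint' k u
      · refine Integrable.div_const (Integrable.add ((hint k u).const_mul c) ?_) 2
        exact (LinearIsometryEquiv.integrable_comp_iff Complex.conjLIE).2
          ((hint k (-u)).const_mul c)
      · exact (hint k u).const_mul c
      · exact (LinearIsometryEquiv.integrable_comp_iff Complex.conjLIE).2
          ((hint k (-u)).const_mul c)
    have e3 : ∫ t : ℝ, (1 - (c * F t).re) ∂(gaussianReal 0 k) =
        1 - (c * ∫ t : ℝ, F t ∂(gaussianReal 0 k)).re := by
      have hre : Integrable (fun t => (c * F t).re) (gaussianReal 0 k) := hFi'.re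
      rw [integral_sub (integrable_const _) hre, ← integral_const_mul]
      congr 1
      · simp
      · exact integral_re hFi'
    rw [← e1, ← e3]
    refine (norm_integral_le_integral_norm _).trans (le_of_eq ?_)
    refine integral_congr_ae (ae_of_all _ fun t => ?_)
    have h1 : (c * F t).re ≤ 1 := (Complex.re_le_norm _).trans (by
      rw [norm_mul, hc, one_mul]; exact hF1 t)
    simp only [norm_mul, hexp, mul_one, Complex.norm_real, Real.norm_eq_abs]
    exact abs_of_nonneg (by linarith)
  have hlim1 := (hD.sub (((hB.const_mul c).add
    ((Complex.continuous_conj.tendsto _).comp (hC.const_mul c))).div_const 2)).norm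
  have hlim2 := ((Complex.continuous_re.tendsto _).comp (hA.const_mul c)).const_sub 1
  have := le_of_tendsto_of_tendsto' hlim1 hlim2 key
  rw [hca, term_zero, mul_zero, map_zero, add_zero, zero_sub, norm_neg, norm_div, norm_mul, hc,
    norm_term_eq, if_neg (by omega)] at this
  simp only [mul_one, Complex.ofReal_re, one_mul, Complex.norm_ofNat, Complex.re_ofNat] at this
  linarith

/-! ### The unit disk: an admissible exponent -/

lemma infDist_frontier_convexHull_unitBall {z : ℂ} (hz : ‖z‖ ≤ 1) :
    Metric.infDist z (frontier (convexHull ℝ (Metric.ball (0 : ℂ) 1))) = 1 - ‖z‖ := by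
  rw [(convex_ball (0 : ℂ) 1).convexHull_eq, frontier_ball _ one_ne_zero]
  obtain ⟨u, hu, hz'⟩ := exists_norm_eq_one_mul_eq z 1 norm_one
  apply le_antisymm
  · have hmem : (starRingEnd ℂ) u ∈ Metric.sphere (0 : ℂ) 1 := by simpa using hu
    refine (Metric.infDist_le_dist_of_mem hmem).trans (le_of_eq ?_)
    have h1 : u * (starRingEnd ℂ) u = 1 := by rw [Complex.mul_conj']; simp [hu]
    have h2 : ‖z - (starRingEnd ℂ) u‖ = ‖u * (z - (starRingEnd ℂ) u)‖ := by
      rw [norm_mul, hu, one_mul]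
    rw [dist_eq_norm, h2, mul_sub, hz', h1, mul_one, norm_sub_rev]
    have h3 : (1 : ℂ) - ‖z‖ = ((1 - ‖z‖ : ℝ) : ℂ) := by push_cast; rfl
    rw [h3, Complex.norm_real, Real.norm_eq_abs, abs_of_nonneg (by linarith)]
  · refine (Metric.le_infDist ⟨1, by simp⟩).2 fun y hy => ?_
    rw [mem_sphere_zero_iff_norm] at hy
    rw [dist_comm, dist_eq_norm, ← hy]
    exact norm_sub_norm_le y z

lemma norm_coeff_one_le {f : ℂ → ℂ} {a : ℕ → ℂ} (h : HasDirichletSeries f a)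
    (hf : Set.MapsTo f rightHalfPlane (Metric.ball 0 1)) : ‖a 1‖ ≤ 1 := by
  refine le_of_tendsto h.tendsto.norm ?_
  filter_upwards [eventually_gt_atTop 0] with x hx
  exact (mem_ball_zero_iff.1 (hf (by simpa [rightHalfPlane] using hx))).le

lemma bohrInequality_unitBall_of_sum_le {f : ℂ → ℂ} {a : ℕ → ℂ} {σ σ' : ℝ}
    (h : HasDirichletSeries f a) (hf : Set.MapsTo f rightHalfPlane (Metric.ball 0 1))
    (hσ : σ < σ') (hsum : ∀ N : ℕ,
      ∑ n ∈ Finset.range N, ‖a (n + 2)‖ / ((n + 2 : ℕ) : ℝ) ^ σ ≤ 1 - ‖a 1‖) :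
    BohrInequality (Metric.ball 0 1) a σ' := by
  refine bohrInequality_of_sum_le h hf (fun z hz => ?_) hσ ?_
  · rw [mem_ball_zero_iff] at hz
    rw [infDist_frontier_convexHull_unitBall hz.le]
    linarith
  · rwa [infDist_frontier_convexHull_unitBall (norm_coeff_one_le h hf)]

lemma bohrSet_convClass_unitBall_nonempty :
    (bohrSet convClass (Metric.ball (0 : ℂ) 1)).Nonempty := by
  refine ⟨6, by norm_num, fun f a h hf => ?_⟩
  -- Two powers of `n` absorb the coefficient bound, and three more make the rest telescope, as `2 /
  -- (N + 2)³ ≤ 1 / (N + 1) - 1 / (N + 2)`. The step from `5` to `6` buys strictness.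
  refine bohrInequality_unitBall_of_sum_le (σ := 5) h.2 hf (by norm_num) fun N => ?_
  have h1 : 0 ≤ 1 - ‖a 1‖ := sub_nonneg.2 (norm_coeff_one_le h.2 hf)
  suffices H : ∑ n ∈ Finset.range N, ‖a (n + 2)‖ / ((n + 2 : ℕ) : ℝ) ^ (5 : ℝ) ≤
      (1 - ‖a 1‖) * (1 - 1 / (N + 1 : ℝ)) by
    refine H.trans (mul_le_of_le_one_right h1 ?_)
    have : 0 ≤ 1 / (N + 1 : ℝ) := by positivity
    linarith
  induction N with
  | zero => simp
  | succ N ih =>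
    rw [Finset.sum_range_succ]
    have h2 := norm_coeff_le h hf (N + 2) (by omega)
    have h3 : ‖a (N + 2)‖ / ((N + 2 : ℕ) : ℝ) ^ (5 : ℝ) =
        ‖a (N + 2)‖ / ((N + 2 : ℕ) : ℝ) ^ (2 : ℝ) * (1 / (N + 2 : ℝ) ^ 3) := by
      rw [show (5 : ℝ) = 2 + (3 : ℕ) by norm_num, Real.rpow_add (by positivity),
        Real.rpow_natCast]
      push_cast
      field_simp
    have h4 : 2 * (1 / (N + 2 : ℝ) ^ 3) ≤ 1 / (N + 1 : ℝ) - 1 / (N + 2 : ℝ) := by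
      rw [div_sub_div _ _ (by positivity) (by positivity), mul_one_div,
        div_le_div_iff₀ (by positivity) (by positivity)]
      have : (0 : ℝ) ≤ N := N.cast_nonneg
      nlinarith [mul_nonneg this this]
    have h5 : ‖a (N + 2)‖ / ((N + 2 : ℕ) : ℝ) ^ (5 : ℝ) ≤
        (1 - ‖a 1‖) * (1 / (N + 1 : ℝ) - 1 / (N + 2 : ℝ)) := by
      rw [h3]
      calc _ ≤ 2 * (1 - ‖a 1‖) * (1 / (N + 2 : ℝ) ^ 3) := by gcongr
        _ = (1 - ‖a 1‖) * (2 * (1 / (N + 2 : ℝ) ^ 3)) := by ring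
        _ ≤ _ := mul_le_mul_of_nonneg_left h4 h1
    have h6 : ((N + 1 : ℕ) : ℝ) + 1 = N + 2 := by push_cast; ring
    rw [h6]
    linarith

/-! ### From the disk to the half-plane -/

lemma affine_coeff_one (a : ℕ → ℂ) (α β : ℂ) :
    (α • LSeries.delta + β • a) 1 = α + β * a 1 := by
  simp [LSeries.delta]

lemma norm_affine_coeff_add_two (a : ℕ → ℂ) (α β : ℂ) (n : ℕ) :
    ‖(α • LSeries.delta + β • a) (n + 2)‖ = ‖β‖ * ‖a (n + 2)‖ := by
  simp [LSeries.delta]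

lemma norm_coeff_shift (a : ℕ → ℂ) (η : ℝ) (n : ℕ) :
    ‖a (n + 2) / ((n + 2 : ℕ) : ℂ) ^ (η : ℂ)‖ = ‖a (n + 2)‖ / ((n + 2 : ℕ) : ℝ) ^ η := by
  rw [norm_div, ← Complex.ofReal_natCast, Complex.norm_cpow_eq_rpow_re_of_pos (by positivity),
    Complex.ofReal_re]

lemma HasAbsDirichletSeries.exists_norm_shift_le {f : ℂ → ℂ} {a : ℕ → ℂ}
    (h : HasAbsDirichletSeries f a) {η : ℝ} (hη : 0 < η) :
    ∃ C : ℝ, ∀ s ∈ rightHalfPlane, ‖f (s + η)‖ ≤ C := by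
  have hη' : (η : ℂ) ∈ rightHalfPlane := by simpa [rightHalfPlane] using hη
  refine ⟨∑' n, ‖term a (η : ℂ) n‖, fun s hs => ?_⟩
  have hs' : s + η ∈ rightHalfPlane := by
    simp only [rightHalfPlane, Set.mem_ofPred_eq, Complex.add_re, Complex.ofReal_re] at hs ⊢
    linarith
  have h1 := (h _ hs').LSeriesSummable.norm
  rw [h.eqOn_LSeries hs']
  refine (norm_tsum_le_tsum_norm h1).trans
    (h1.tsum_le_tsum (fun n => ?_) (h _ hη').LSeriesSummable.norm)
  refine norm_term_le_of_re_le_re a ?_ n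
  simpa [rightHalfPlane] using hs.le

/-- The Bohr inequality for the disk implies the one for the half-plane. -/
lemma sum_le_re_of_mem_bohrSet {σ : ℝ} (hσ : σ ∈ bohrSet convClass (Metric.ball (0 : ℂ) 1))
    {h : ℂ → ℂ} {a : ℕ → ℂ} (ha : HasAbsDirichletSeries h a)
    (hre : ∀ s ∈ rightHalfPlane, 0 ≤ (h s).re) (N : ℕ) :
    ∑ n ∈ Finset.range N, ‖a (n + 2)‖ / ((n + 2 : ℕ) : ℝ) ^ σ ≤ (a 1).re := by
  have key : ∀ η : ℝ, 0 < η →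
      ∑ n ∈ Finset.range N, ‖a (n + 2)‖ / ((n + 2 : ℕ) : ℝ) ^ η / ((n + 2 : ℕ) : ℝ) ^ σ
        ≤ (a 1).re + η := by
    intro η hη
    obtain ⟨C, hC⟩ := ha.exists_norm_shift_le hη
    have h1mem : (1 : ℂ) ∈ rightHalfPlane := by simp [rightHalfPlane]
    have hC0 : 0 ≤ C := (norm_nonneg _).trans (hC 1 h1mem)
    set D := C + η
    have hD : 0 < D := by positivity
    -- With `Re w ≥ η` and `‖w‖ ≤ D`, this choice gives `‖1 - ε w‖² ≤ 1 - 2 ε η + ε² D² = 1 - ε η <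
    -- 1`.
    set ε := η / D ^ 2
    have hε : 0 < ε := by positivity
    have hg := (ha.shift hη.le).affine ((1 - ε * η : ℝ) : ℂ) ((-ε : ℝ) : ℂ)
    set b : ℕ → ℂ := fun n => a n / (n : ℂ) ^ (η : ℂ)
    set g : ℂ → ℂ := fun s => ((1 - ε * η : ℝ) : ℂ) + ((-ε : ℝ) : ℂ) * h (s + η)
    have hmaps : Set.MapsTo g rightHalfPlane (Metric.ball 0 1) := by
      intro s hs
      have hs' : s + η ∈ rightHalfPlane := by
        simp only [rightHalfPlane, Set.mem_ofPred_eq, Complex.add_re, Complex.ofReal_re] at hs ⊢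
        linarith
      set w : ℂ := h (s + η) + η
      have hw : ‖w‖ ≤ D := (norm_add_le _ _).trans (by
        rw [Complex.norm_real, Real.norm_eq_abs, abs_of_pos hη]
        exact add_le_add_left (hC s hs) η)
      have hwre : η ≤ w.re := by
        have := hre _ hs'
        simp only [w, Complex.add_re, Complex.ofReal_re] at this ⊢
        linarith
      have hgw : g s = 1 - ε * w := by
        simp only [g, w]
        push_cast
        ring
      have hsq : ‖g s‖ ^ 2 = 1 - 2 * ε * w.re + ε ^ 2 * ‖w‖ ^ 2 := by
        rw [hgw, ← Complex.normSq_eq_norm_sq, ← Complex.normSq_eq_norm_sq, Complex.normSq_apply,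
          Complex.normSq_apply]
        simp
        ring
      have h3 : ε ^ 2 * ‖w‖ ^ 2 ≤ ε * η := by
        calc ε ^ 2 * ‖w‖ ^ 2 ≤ ε ^ 2 * D ^ 2 := by gcongr
          _ = ε * η := by simp only [ε]; field_simp
      have h4 : ε * η ≤ ε * w.re := mul_le_mul_of_nonneg_left hwre hε.le
      have h5 : 0 < ε * η := by positivity
      rw [mem_ball_zero_iff]
      exact lt_of_pow_lt_pow_left₀ 2 zero_le_one (by rw [hsq]; linarith)
    have hconv : convClass g (((1 - ε * η : ℝ) : ℂ) • LSeries.delta + ((-ε : ℝ) : ℂ) • b) :=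
      ⟨⟨hg.differentiableOn, 1, fun s hs => (mem_ball_zero_iff.1 (hmaps hs)).le⟩,
        hg.hasDirichletSeries⟩
    obtain ⟨hsum, hlt⟩ := hσ.2 g _ hconv hmaps
    rw [infDist_frontier_convexHull_unitBall (norm_coeff_one_le hconv.2 hmaps)] at hlt
    have h6 := (hsum.sum_le_tsum (Finset.range N) fun n _ => by positivity).trans hlt.le
    have h7 : 1 - ε * ((a 1).re + η) ≤
        ‖(((1 - ε * η : ℝ) : ℂ) • LSeries.delta + ((-ε : ℝ) : ℂ) • b) 1‖ := by
      refine le_trans (le_of_eq ?_) (Complex.re_le_norm _)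
      rw [affine_coeff_one]
      simp [b]
      ring
    simp_rw [norm_affine_coeff_add_two, b, norm_coeff_shift, Complex.norm_real, norm_neg,
      Real.norm_eq_abs, abs_of_pos hε, mul_div_assoc, ← Finset.mul_sum] at h6
    exact le_of_mul_le_mul_left (by simpa only [mul_div_assoc] using h6.trans (by linarith)) hε
  have hlim : Tendsto (fun η : ℝ => ∑ n ∈ Finset.range N,
      ‖a (n + 2)‖ / ((n + 2 : ℕ) : ℝ) ^ η / ((n + 2 : ℕ) : ℝ) ^ σ) (𝓝[>] 0)
      (𝓝 (∑ n ∈ Finset.range N, ‖a (n + 2)‖ / ((n + 2 : ℕ) : ℝ) ^ σ)) := by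
    have hcont : Continuous (fun η : ℝ => ∑ n ∈ Finset.range N,
        ‖a (n + 2)‖ / ((n + 2 : ℕ) : ℝ) ^ η / ((n + 2 : ℕ) : ℝ) ^ σ) := by
      refine continuous_finsetSum _ fun n _ => Continuous.div_const
        (continuous_const.div ?_ fun η => (Real.rpow_pos_of_pos (by positivity) η).ne') _
      exact Real.continuous_const_rpow (by positivity)
    simpa using (hcont.tendsto 0).mono_left nhdsWithin_le_nhds
  have hlim' : Tendsto (fun η : ℝ => (a 1).re + η) (𝓝[>] 0) (𝓝 (a 1).re) := by
    simpa using ((continuous_const_add (a 1).re).tendsto 0).mono_left nhdsWithin_le_nhds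
  refine le_of_tendsto_of_tendsto hlim hlim' ?_
  filter_upwards [self_mem_nhdsWithin] with η hη using key η hη

/-! ### General domains: separating half-planes and inscribed disks -/

lemma nonempty_frontier_convexHull {G : Set ℂ} (hne : G.Nonempty)
    (hG : convexHull ℝ G ≠ Set.univ) : (frontier (convexHull ℝ G)).Nonempty :=
  nonempty_frontier_iff.2 ⟨hne.convexHull, hG⟩

lemma infDist_frontier_convexHull_pos {G : Set ℂ} (hGo : IsOpen G)
    (hG : convexHull ℝ G ≠ Set.univ) {z : ℂ} (hz : z ∈ G) :
    0 < Metric.infDist z (frontier (convexHull ℝ G)) := by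
  refine (isClosed_frontier.notMem_iff_infDist_pos (nonempty_frontier_convexHull ⟨z, hz⟩ hG)).1 ?_
  rw [hGo.convexHull.frontier_eq]
  exact fun h => h.2 (subset_convexHull ℝ G hz)

lemma mem_bohrSet_of_unitBall {G : Set ℂ} (hGo : IsOpen G) (hne : G.Nonempty)
    (hG : convexHull ℝ G ≠ Set.univ) {σ σ' : ℝ}
    (hσ : σ ∈ bohrSet convClass (Metric.ball (0 : ℂ) 1)) (hσσ' : σ < σ') :
    σ' ∈ bohrSet HasAbsDirichletSeries G := by
  refine ⟨hσ.1.trans hσσ'.le, fun f a h hf => ?_⟩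
  refine bohrInequality_of_sum_le h.hasDirichletSeries hf
    (fun z hz => infDist_frontier_convexHull_pos hGo hG hz) hσσ' fun N => ?_
  obtain ⟨p, hp, hdist⟩ :=
    isClosed_frontier.exists_infDist_eq_dist (nonempty_frontier_convexHull hne hG) (a 1)
  have hpK : p ∉ convexHull ℝ G := by
    rw [hGo.convexHull.frontier_eq] at hp
    exact hp.2
  obtain ⟨L, hL⟩ := RCLike.geometric_hahn_banach_open_point (𝕜 := ℂ) (convex_convexHull ℝ G)
    hGo.convexHull hpK
  have hL1 : ∀ z, L z = L 1 * z := fun z => by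
    have := L.map_smul z 1
    rwa [smul_eq_mul, mul_one, smul_eq_mul, mul_comm] at this
  have hL0 : 0 < ‖L 1‖ := by
    obtain ⟨z, hz⟩ := hne
    refine norm_pos_iff.2 fun h0 => ?_
    have := hL z (subset_convexHull ℝ G hz)
    rw [hL1 z, hL1 p, h0, zero_mul, zero_mul] at this
    exact lt_irrefl _ this
  -- The half-plane inequality is applied to `L 1 * (p - f)`; the factor `‖L 1‖` cancels at the end.
  have h1 := sum_le_re_of_mem_bohrSet hσ (h.affine (L 1 * p) (-L 1)) (fun s hs => by
    have := hL _ (subset_convexHull ℝ G (hf hs))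
    rw [hL1 (f s), hL1 p] at this
    simp only [RCLike.re_to_complex] at this
    rw [neg_mul, Complex.add_re, Complex.neg_re]
    linarith) N
  simp_rw [norm_affine_coeff_add_two, norm_neg, mul_div_assoc, ← Finset.mul_sum,
    affine_coeff_one] at h1
  rw [hdist]
  refine le_of_mul_le_mul_left (h1.trans ((Complex.re_le_norm _).trans (le_of_eq ?_))) hL0
  rw [dist_comm, dist_eq_norm, ← norm_mul]
  ring_nf

/-- Near a regular point of convexity, functions into `G` obtained from smoothed functions into
the unit disk recover the Bohr inequality of the disk. -/
lemma sum_le_of_mem_bohrSet {G : Set ℂ} {p : ℂ} (hp : IsRegularPointOfConvexity G p) {σ : ℝ}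
    (hσ : σ ∈ bohrSet absClass G) {f : ℂ → ℂ} {a : ℕ → ℂ} (h : convClass f a)
    (hf : Set.MapsTo f rightHalfPlane (Metric.ball 0 1)) (N : ℕ) :
    ∑ n ∈ Finset.range N, ‖a (n + 2)‖ / ((n + 2 : ℕ) : ℝ) ^ σ ≤ 1 - ‖a 1‖ := by
  obtain ⟨⟨-, hpK⟩, c, r, hr, hball, hpB⟩ := hp
  rw [frontier_ball _ hr.ne', mem_sphere_iff_norm] at hpB
  have hr' : (r : ℂ) ≠ 0 := by exact_mod_cast hr.ne'
  -- The rotation `u` turns `a 1` towards `p`, so that the new constant term lies on the radius from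
  -- `c` to `p`.
  obtain ⟨u, hu, hua⟩ := exists_norm_eq_one_mul_eq (a 1) ((p - c) / r) (by
    rw [norm_div, hpB, Complex.norm_real, Real.norm_eq_abs, abs_of_pos hr, div_self hr.ne'])
  have key : ∀ x : ℝ, 0 < x → x < 1 →
      ∑ n ∈ Finset.range N, (1 - x) * (‖a (n + 2)‖ *
        Real.exp (-(x * Real.log (n + 2 : ℕ) ^ 2 / 2))) / ((n + 2 : ℕ) : ℝ) ^ σ
        ≤ 1 - (1 - x) * ‖a 1‖ := by
    -- The parameter `x` is both the variance of the Gaussian and the contraction that moves the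
    -- closed disk into the open one.
    intro x hx0 hx1
    lift x to NNReal using hx0.le
    have hg := hasAbsDirichletSeries_integral_gaussianReal h (v := x) (NNReal.coe_pos.1 hx0)
    have hF := hg.affine c ((r * (1 - x) : ℝ) * u)
    have hβ : ‖((r * (1 - x) : ℝ) : ℂ) * u‖ = r * (1 - x) := by
      rw [norm_mul, hu, mul_one, Complex.norm_real, Real.norm_eq_abs,
        abs_of_pos (mul_pos hr (sub_pos.2 hx1))]
    have hgle : ∀ s ∈ rightHalfPlane,
        ‖∫ t : ℝ, f (s + t * Complex.I) ∂(gaussianReal 0 x)‖ ≤ 1 := fun s hs => by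
      simpa using norm_integral_le_of_norm_le_const (μ := gaussianReal 0 x)
        (ae_of_all _ fun t : ℝ => (mem_ball_zero_iff.1 (hf (add_mul_I_mem hs t))).le)
    set b : ℕ → ℂ := fun n =>
      a n * Real.exp (-(x * Real.log n ^ 2 / 2))
    set g : ℂ → ℂ := fun s => ∫ t : ℝ, f (s + t * Complex.I) ∂(gaussianReal 0 x)
    have hmaps : Set.MapsTo (fun s => c + (r * (1 - x) : ℝ) * u * g s) rightHalfPlane
        (Metric.ball c r) := fun s hs => by
      rw [mem_ball_iff_norm, add_sub_cancel_left, norm_mul, hβ]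
      calc r * (1 - x) * ‖g s‖ ≤ r * (1 - x) * 1 :=
            mul_le_mul_of_nonneg_left (hgle s hs) (mul_pos hr (sub_pos.2 hx1)).le
        _ < r := by nlinarith
    have hH : IsHInfty fun s => c + (r * (1 - x) : ℝ) * u * g s :=
      ⟨hF.differentiableOn, ‖c‖ + r, fun s hs => by
        have h1 := mem_ball_iff_norm.1 (hmaps hs)
        have h2 := norm_add_le c (c + (r * (1 - x) : ℝ) * u * g s - c)
        rw [add_sub_cancel] at h2
        linarith⟩
    obtain ⟨hsum, hlt⟩ := hσ.2 _ _ ⟨hH, hF⟩ fun s hs => hball (hmaps hs)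
    have h6 := (hsum.sum_le_tsum (Finset.range N) fun n _ => by positivity).trans
      (hlt.le.trans (Metric.infDist_le_dist_of_mem hpK))
    have hb1 : b 1 = a 1 := by simp [b]
    have hbn : ∀ n : ℕ, ‖b (n + 2)‖ =
        ‖a (n + 2)‖ * Real.exp (-(x * Real.log (n + 2 : ℕ) ^ 2 / 2)) := fun n => by
      simp only [b, norm_mul, Complex.norm_real, Real.norm_eq_abs, Real.abs_exp]
    have ha1 : ‖a 1‖ ≤ 1 := norm_coeff_one_le h.2 hf
    have hd : dist (c + (r * (1 - x) : ℝ) * u * a 1) p = r * (1 - (1 - x) * ‖a 1‖) := by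
      have h7 : p - (c + (r * (1 - x) : ℝ) * u * a 1) =
          ((1 - (1 - x) * ‖a 1‖ : ℝ) : ℂ) * (p - c) := by
        rw [mul_assoc, hua]
        push_cast
        field_simp
        ring
      rw [dist_comm, dist_eq_norm, h7, norm_mul, hpB, Complex.norm_real, Real.norm_eq_abs,
        abs_of_nonneg (by nlinarith [norm_nonneg (a 1)]), mul_comm]
    rw [affine_coeff_one, hb1, hd] at h6
    simp_rw [norm_affine_coeff_add_two, hβ, hbn, mul_assoc r, mul_div_assoc r, ← Finset.mul_sum]
      at h6
    exact le_of_mul_le_mul_left h6 hr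
  have hlim : Tendsto (fun x : ℝ => ∑ n ∈ Finset.range N, (1 - x) * (‖a (n + 2)‖ *
        Real.exp (-(x * Real.log (n + 2 : ℕ) ^ 2 / 2))) / ((n + 2 : ℕ) : ℝ) ^ σ) (𝓝[>] 0)
      (𝓝 (∑ n ∈ Finset.range N, ‖a (n + 2)‖ / ((n + 2 : ℕ) : ℝ) ^ σ)) := by
    have hcont : Continuous (fun x : ℝ => ∑ n ∈ Finset.range N, (1 - x) * (‖a (n + 2)‖ *
        Real.exp (-(x * Real.log (n + 2 : ℕ) ^ 2 / 2))) / ((n + 2 : ℕ) : ℝ) ^ σ) :=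
      continuous_finsetSum _ fun n _ => Continuous.div_const (by fun_prop) _
    simpa using (hcont.tendsto 0).mono_left nhdsWithin_le_nhds
  have hlim' : Tendsto (fun x : ℝ => 1 - (1 - x) * ‖a 1‖) (𝓝[>] 0) (𝓝 (1 - ‖a 1‖)) := by
    have hcont : Continuous (fun x : ℝ => 1 - (1 - x) * ‖a 1‖) := by fun_prop
    simpa using (hcont.tendsto 0).mono_left nhdsWithin_le_nhds
  refine le_of_tendsto_of_tendsto hlim hlim' ?_
  filter_upwards [Ioo_mem_nhdsGT one_pos] with x hx using key x hx.1 hx.2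

lemma mem_bohrSet_unitBall {G : Set ℂ} {p : ℂ} (hp : IsRegularPointOfConvexity G p) {σ σ' : ℝ}
    (hσ : σ ∈ bohrSet absClass G) (hσσ' : σ < σ') :
    σ' ∈ bohrSet convClass (Metric.ball (0 : ℂ) 1) :=
  ⟨hσ.1.trans hσσ'.le, fun _ _ h hf => bohrInequality_unitBall_of_sum_le h.2 hf hσσ'
    (sum_le_of_mem_bohrSet hp hσ h hf)⟩

/-! ### Comparison of the infima -/

lemma bohrSet_unbdd_subset (G : Set ℂ) : bohrSet HasAbsDirichletSeries G ⊆ bohrSet absClass G :=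
  fun _ hσ => ⟨hσ.1, fun f a h => hσ.2 f a h.2⟩

lemma bddBelow_bohrSet (C : (ℂ → ℂ) → (ℕ → ℂ) → Prop) (G : Set ℂ) : BddBelow (bohrSet C G) :=
  ⟨0, fun _ hσ => hσ.1⟩

lemma csInf_le_csInf_of_forall_lt {S T : Set ℝ} (hS : BddBelow S) (hT : T.Nonempty)
    (h : ∀ σ ∈ T, ∀ σ', σ < σ' → σ' ∈ S) : sInf S ≤ sInf T :=
  le_csInf hT fun σ hσ => le_of_forall_gt_imp_ge_of_dense fun σ' hσ' =>
    csInf_le hS (h σ hσ σ' hσ')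

end DirichletBohr

theorem theorem2p3 (G : Set ℂ) (hGo : IsOpen G) (hGc : IsConnected G)
    (hG : convexHull ℝ G ≠ Set.univ) :
    -- the sets whose infima are the abscissas are non-empty
    ((DirichletBohr.bohrSet DirichletBohr.convClass (Metric.ball (0 : ℂ) 1)).Nonempty ∧
      (DirichletBohr.bohrSet DirichletBohr.absClass G).Nonempty ∧
      (DirichletBohr.bohrSet DirichletBohr.HasAbsDirichletSeries G).Nonempty) ∧
    -- the inequality
    (DirichletBohr.absBohrAbscissa G ≤ DirichletBohr.bohrAbscissa (Metric.ball (0 : ℂ) 1) ∧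
      DirichletBohr.absBohrAbscissaUnbdd G
        ≤ DirichletBohr.bohrAbscissa (Metric.ball (0 : ℂ) 1)) ∧
    -- equality if the boundary contains a regular point of convexity
    ((∃ p : ℂ, DirichletBohr.IsRegularPointOfConvexity G p) →
      DirichletBohr.absBohrAbscissa G = DirichletBohr.bohrAbscissa (Metric.ball (0 : ℂ) 1) ∧
      DirichletBohr.absBohrAbscissaUnbdd G
        = DirichletBohr.bohrAbscissa (Metric.ball (0 : ℂ) 1)) := by
  have hU := DirichletBohr.bohrSet_convClass_unitBall_nonempty
  have hmem : ∀ σ ∈ DirichletBohr.bohrSet DirichletBohr.convClass (Metric.ball (0 : ℂ) 1),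
      ∀ σ', σ < σ' → σ' ∈ DirichletBohr.bohrSet DirichletBohr.HasAbsDirichletSeries G :=
    fun σ hσ σ' h => DirichletBohr.mem_bohrSet_of_unitBall hGo hGc.nonempty hG hσ h
  have hsub := DirichletBohr.bohrSet_unbdd_subset G
  have hunb : (DirichletBohr.bohrSet DirichletBohr.HasAbsDirichletSeries G).Nonempty := by
    obtain ⟨σ, hσ⟩ := hU
    exact ⟨σ + 1, hmem σ hσ _ (lt_add_one σ)⟩
  have hle₁ : DirichletBohr.absBohrAbscissaUnbdd G
      ≤ DirichletBohr.bohrAbscissa (Metric.ball (0 : ℂ) 1) :=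
    DirichletBohr.csInf_le_csInf_of_forall_lt (DirichletBohr.bddBelow_bohrSet _ _) hU hmem
  have hle₂ : DirichletBohr.absBohrAbscissa G ≤ DirichletBohr.absBohrAbscissaUnbdd G :=
    csInf_le_csInf (DirichletBohr.bddBelow_bohrSet _ _) hunb hsub
  refine ⟨⟨hU, hunb.mono hsub, hunb⟩, ⟨hle₂.trans hle₁, hle₁⟩, ?_⟩
  rintro ⟨p, hp⟩
  have hle₃ : DirichletBohr.bohrAbscissa (Metric.ball (0 : ℂ) 1)
      ≤ DirichletBohr.absBohrAbscissa G :=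
    DirichletBohr.csInf_le_csInf_of_forall_lt (DirichletBohr.bddBelow_bohrSet _ _)
      (hunb.mono hsub) fun σ hσ σ' h => DirichletBohr.mem_bohrSet_unitBall hp hσ h
  exact ⟨le_antisymm (hle₂.trans hle₁) hle₃, le_antisymm hle₁ (hle₃.trans hle₂)⟩
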